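/- Let $p$ be a prime, let $n\ge 1$, and let $\mathcal F=\{F_1,\dots,F_n\}$ be a finite family of maps $F_i:\mathbb Q_p\to\mathbb Q_p$ of the form $F_i(x)=(-1)^{b_i}p^{k_i}x+d_i$ with $b_i\in\{0,1\}$, $k_i\in\mathbb Z$, $k_i\ge 1$ and $d_i\in\mathbb Z_p\cap\mathbb Q$. Let $K\subseteq\mathbb Q_p$ be the associated $p$-adic self-similar set, that is, the unique nonempty compact set with $K=\bigcup_i F_i(K)$ (it is contained in $\mathbb Z_p$). The language of $p$-adic expansions of $\mathcal F$ is the set $L$ of all sequences $a_0a_1a_2\dots\in\{0,\dots,p-1\}^{\mathbb N}$ with $\sum_{i\ge0}a_ip^i\in K$. A finite automaton over $\{0,\dots,p-1\}$ consists of a finite set $Q$ of states, all of them accepting, a set $E\subseteq Q\times\{0,\dots,p-1\}\times Q$ of transitions, and an initial state. It is deterministic if for all $q\in Q$ and $a\in\{0,\dots,p-1\}$ there is at most one $q'$ with $(q,a,q')\in E$. A finite word is accepted if it labels a path that starts in the initial state; an infinite word is accepted if all its finite prefixes are. The automaton recognizes $L$ if the infinite words it accepts are exactly the elements of $L$ and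 the finite words it accepts are exactly the finite prefixes of elements of $L$. An essential class is a strongly connected component $C\subseteq Q$ of the directed graph of transitions such that every path starting in $C$ stays in $C$. Then there exists a deterministic finite automaton that recognizes $L$ and has exactly one essential class. -/

import Mathlib

/-- A finite automaton (finiteness of the state set `Q` is imposed where it is used) over the
alphabet `A`: a set of labelled transitions and an initial state; all states are accepting. -/
structure PathAutomaton (A Q : Type*) where
  /-- the transitions `(q, a, q')` -/
  trans : Set (Q × A × Q)
  /-- the initial state -/
  init : Q

namespace PathAutomaton

variable {A Q : Type*} (M : PathAutomaton A Q)

/-- From each state at most one transition carries a given label. -/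
def IsDeterministic : Prop :=
  ∀ q a r r', (q, a, r) ∈ M.trans → (q, a, r') ∈ M.trans → r = r'

/-- There is a path from the first state to the last one that is labelled by the given word. -/
def IsPath : Q → List A → Q → Prop
  | q, [], r => q = r
  | q, a :: w, r => ∃ s, (q, a, s) ∈ M.trans ∧ IsPath s w r

/-- The finite word `w` is accepted. -/
def Accepts (w : List A) : Prop := ∃ q, M.IsPath M.init w q

/-- The infinite word `a` is accepted: all its finite prefixes are. -/
def AcceptsInf (a : ℕ → A) : Prop := ∀ n : ℕ, M.Accepts (List.ofFn fun i : Fin n => a i)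

/-- The automaton recognizes the language `L` of infinite words: the infinite words it accepts are
those in `L`, and the finite words it accepts are the finite prefixes of the members of `L`
(so no path from the initial state runs into a dead end). -/
def Recognizes (L : Set (ℕ → A)) : Prop :=
  (∀ a, M.AcceptsInf a ↔ a ∈ L) ∧
    ∀ w, M.Accepts w ↔ ∃ a ∈ L, ∃ n : ℕ, w = List.ofFn fun i : Fin n => a i

/-- There is a transition from `q` to `r`. -/
def Edge (q r : Q) : Prop := ∃ a, (q, a, r) ∈ M.trans

/-- Loop classes: nonempty sets of states in which any state can be reached from any state by a
path inside the set. -/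
def IsLoopClass (C : Set Q) : Prop :=
  C.Nonempty ∧ ∀ q ∈ C, ∀ r ∈ C,
    Relation.ReflTransGen (fun s t => s ∈ C ∧ t ∈ C ∧ M.Edge s t) q r

/-- Essential classes: maximal loop classes (strongly connected components) that no path leaves. -/
def IsEssentialClass (C : Set Q) : Prop :=
  Maximal M.IsLoopClass C ∧ ∀ q ∈ C, ∀ r, Relation.ReflTransGen M.Edge q r → r ∈ C

end PathAutomaton

/-- `K` is the attractor of the family of maps `F`: a nonempty compact set that is the union of its
images under the maps. -/
def IsAttractor {X ι : Type*} [TopologicalSpace X] (F : ι → X → X) (K : Set X) : Prop :=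
  K.Nonempty ∧ IsCompact K ∧ K = ⋃ i, F i '' K

/-- The language of `p`-adic expansions of `K`: the digit sequences `a` with `∑ aᵢ pⁱ ∈ K`. -/
def expansionLanguage (p : ℕ) [Fact p.Prime] (K : Set ℚ_[p]) : Set (ℕ → Fin p) :=
  {a | ∃ x ∈ K, HasSum (fun i : ℕ => ((a i : ℕ) : ℚ_[p]) * (p : ℚ_[p]) ^ i) x}

/-! View `K` as a closed subset X of `ℤ_[p]`. The states are the nonempty residuals of X, the sets
of tails that complete a given word to a point of X. Closedness of X makes this deterministic
automaton recognize the language. It is finite because every residual is a union of affine pieces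
±p^m X + N/D with bounded m and N (`finite_wordResiduals`).

For the essential class it suffices to find a state S reachable from all states. If X is a point,
any two of its prefixes extend to a common one. Otherwise let S be maximal for inclusion among the
recurrent states, those reachable from everything they reach. Every state leads to a recurrent one,
and from there to a residual containing a translate X + r with r an integer
(`exists_translate_subset`). Now S is the residual of X along a word so central that adding r to its
value causes no carry past its end (`exists_isCentralWord`). Hence S lies in a residual T reached
from that state (`exists_wordResidual_subset_of_translate`). As T is again recurrent, maximality
gives T = S. -/

/-! ### Essential classes and recurrence in directed graphs -/

namespace PathAutomaton

variable {A Q : Type*} (M : PathAutomaton A Q)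

/-- The class is the set of states reachable from `S`. Any essential class contains `S`, because no
path leaves it, and therefore equals this set. -/
theorem existsUnique_isEssentialClass {S : Q}
    (hS : ∀ q, Relation.ReflTransGen M.Edge q S) : ∃! C : Set Q, M.IsEssentialClass C := by
  have inside : ∀ C : Set Q, (∀ q ∈ C, ∀ r, Relation.ReflTransGen M.Edge q r → r ∈ C) →
      ∀ q ∈ C, ∀ r, Relation.ReflTransGen M.Edge q r →
        Relation.ReflTransGen (fun s t => s ∈ C ∧ t ∈ C ∧ M.Edge s t) q r := by
    intro C hC q hq r hqr
    induction hqr with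
    | refl => exact .refl
    | tail h1 h2 ih => exact ih.tail ⟨hC _ hq _ h1, hC _ hq _ (h1.tail h2), h2⟩
  have forget : ∀ (C : Set Q) q r,
      Relation.ReflTransGen (fun s t => s ∈ C ∧ t ∈ C ∧ M.Edge s t) q r →
        Relation.ReflTransGen M.Edge q r :=
    fun C q r h => by
      refine Relation.ReflTransGen.mono ?_ _ _ h
      exact fun _ _ h => h.2.2
  have closed : ∀ q ∈ {r | Relation.ReflTransGen M.Edge S r}, ∀ r,
      Relation.ReflTransGen M.Edge q r → r ∈ {r | Relation.ReflTransGen M.Edge S r} :=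
    fun q hq r hqr => Relation.ReflTransGen.trans hq hqr
  have loop : M.IsLoopClass {r | Relation.ReflTransGen M.Edge S r} :=
    ⟨⟨S, .refl⟩, fun q hq r hr => inside _ closed q hq r ((hS q).trans hr)⟩
  refine ⟨{r | Relation.ReflTransGen M.Edge S r}, ⟨⟨loop, fun C hC hle q hq => ?_⟩, closed⟩, ?_⟩
  · exact forget C _ _ (hC.2 S (hle .refl) q hq)
  · rintro C ⟨hmax, hC⟩
    obtain ⟨q, hq⟩ := hmax.prop.1
    have hSC : S ∈ C := hC q hq S (hS q)
    exact Set.Subset.antisymm (fun r hr => forget C _ _ (hmax.prop.2 S hSC r hr))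
      (fun r hr => hC S hSC r hr)

end PathAutomaton

/-- In a finite directed graph, every vertex leads to a vertex that can be reached back from
everything it leads to. -/
theorem exists_recurrent {Q : Type*} [Finite Q] (E : Q → Q → Prop) (q : Q) :
    ∃ r, Relation.ReflTransGen E q r ∧
      ∀ s, Relation.ReflTransGen E r s → Relation.ReflTransGen E s r := by
  -- A vertex with the fewest reachable vertices: moving on from it cannot lose any of them.
  obtain ⟨r, hr, hmin⟩ := Set.exists_min_image {r | Relation.ReflTransGen E q r}
    (fun r => {s | Relation.ReflTransGen E r s}.ncard) (Set.toFinite _) ⟨q, .refl⟩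
  refine ⟨r, hr, fun s hs => ?_⟩
  have hsub : {t | Relation.ReflTransGen E s t} ⊆ {t | Relation.ReflTransGen E r t} :=
    fun t ht => Relation.ReflTransGen.trans hs ht
  have := Set.eq_of_subset_of_ncard_le hsub (hmin s (Relation.ReflTransGen.trans hr hs))
  have hrr : r ∈ {t | Relation.ReflTransGen E r t} := Relation.ReflTransGen.refl
  rw [← this] at hrr
  exact hrr

/-! ### Words as base `p` numbers -/

section Words

variable {p : ℕ}

/-- The natural number with the given base `p` digits, least significant digit first. -/
def wordVal : List (Fin p) → ℕ
  | [] => 0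
  | a :: w => a + p * wordVal w

@[simp] theorem wordVal_nil : wordVal ([] : List (Fin p)) = 0 := rfl

@[simp] theorem wordVal_cons (a : Fin p) (w : List (Fin p)) :
    wordVal (a :: w) = a + p * wordVal w := rfl

theorem wordVal_append (v w : List (Fin p)) :
    wordVal (v ++ w) = wordVal v + p ^ v.length * wordVal w := by
  induction v with
  | nil => simp
  | cons a v ih => simp only [List.cons_append, wordVal_cons, ih, List.length_cons]; ring

theorem wordVal_lt (w : List (Fin p)) : wordVal w < p ^ w.length := by
  induction w with
  | nil => simp
  | cons a w ih =>
    calc (a : ℕ) + p * wordVal w < p + p * wordVal w := by have := a.2; omega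
      _ = p * (wordVal w + 1) := by ring
      _ ≤ p * p ^ w.length := Nat.mul_le_mul_left _ ih
      _ = p ^ (a :: w).length := by rw [List.length_cons, pow_succ']

theorem exists_wordVal_eq (n c : ℕ) (hc : c < p ^ n) :
    ∃ w : List (Fin p), w.length = n ∧ wordVal w = c := by
  induction n generalizing c with
  | zero => exact ⟨[], rfl, by simp at hc; simp [hc]⟩
  | succ n ih =>
    have hp : 0 < p := by
      rcases Nat.eq_zero_or_pos p with rfl | h
      · simp at hc
      · exact h
    obtain ⟨w, hw, hv⟩ := ih (c / p) (Nat.div_lt_of_lt_mul (by rwa [← pow_succ']))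
    exact ⟨⟨c % p, Nat.mod_lt _ hp⟩ :: w, by simp [hw], by simp [hv, Nat.mod_add_div]⟩

theorem wordVal_injective {v w : List (Fin p)} (hl : v.length = w.length)
    (h : wordVal v = wordVal w) : v = w := by
  induction v generalizing w with
  | nil => exact (List.eq_nil_of_length_eq_zero hl.symm).symm
  | cons a v ih =>
    obtain _ | ⟨b, w⟩ := w
    · simp at hl
    · simp only [wordVal_cons] at h
      have h1 : (a : ℕ) = b := by
        have := congrArg (· % p) h
        simpa [Nat.add_mul_mod_self_left, Nat.mod_eq_of_lt a.2, Nat.mod_eq_of_lt b.2] using this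
      have h2 : wordVal v = wordVal w := by
        rw [h1] at h
        exact Nat.eq_of_mul_eq_mul_left (by have := a.2; omega) (Nat.add_left_cancel h)
      rw [Fin.ext h1, ih (by simpa using hl) h2]

theorem wordVal_ofFn (a : ℕ → Fin p) (n : ℕ) :
    wordVal (List.ofFn fun i : Fin n => a i) = ∑ i ∈ Finset.range n, (a i : ℕ) * p ^ i := by
  induction n with
  | zero => simp
  | succ n ih =>
    rw [List.ofFn_succ', List.concat_eq_append, wordVal_append, Finset.sum_range_succ]
    simp only [Fin.val_castSucc, ih, List.length_ofFn, Fin.val_last, wordVal_cons, wordVal_nil]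
    ring

/-- A word is `R`-central if its value is not congruent to an integer of absolute value at most `R`
modulo the power of `p` given by its length. -/
def IsCentralWord (R : ℕ) (v : List (Fin p)) : Prop :=
  ∀ m : ℤ, |m| ≤ R → ¬ (p : ℤ) ^ v.length ∣ wordVal v - m

/-- A congruence modulo the larger power of `p` implies the one modulo the smaller. Centrality thus
survives the path back to a recurrent state. -/
theorem IsCentralWord.append {R : ℕ} {v : List (Fin p)} (hv : IsCentralWord R v)
    (t : List (Fin p)) : IsCentralWord R (v ++ t) := by
  intro m hm hd
  refine hv m hm ?_
  rw [wordVal_append, List.length_append, pow_add] at hd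
  have := dvd_sub ((dvd_mul_right _ _).trans hd)
    (dvd_mul_right ((p : ℤ) ^ v.length) (wordVal t))
  rw [Nat.cast_add, Nat.cast_mul, Nat.cast_pow] at this
  rwa [show (wordVal v : ℤ) - m =
    wordVal v + (p : ℤ) ^ v.length * wordVal t - m - (p : ℤ) ^ v.length * wordVal t by ring]

end Words

/-! ### Prefixes and digits of `p`-adic integers -/

section Padic

variable {p : ℕ} [Fact p.Prime]

theorem PadicInt.eq_of_forall_pow_dvd_sub {x y : ℤ_[p]} (h : ∀ n : ℕ, (p : ℤ_[p]) ^ n ∣ x - y) :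
    x = y := by
  by_contra hne
  have h1 := (PadicInt.norm_le_pow_iff_mem_span_pow (x - y) ((x - y).valuation + 1)).2
    (Ideal.mem_span_singleton.2 (h _))
  rw [PadicInt.norm_le_pow_iff_le_valuation _ (sub_ne_zero.2 hne)] at h1
  omega

theorem PadicInt.isClosed_pow_dvd (n : ℕ) (s : ℤ_[p]) :
    IsClosed {z : ℤ_[p] | (p : ℤ_[p]) ^ n ∣ z - s} := by
  have : {z : ℤ_[p] | (p : ℤ_[p]) ^ n ∣ z - s} = {z | ‖z - s‖ ≤ (p : ℝ) ^ (-n : ℤ)} := by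
    ext z
    rw [Set.mem_ofPred_eq, Set.mem_ofPred_eq, PadicInt.norm_le_pow_iff_mem_span_pow,
      Ideal.mem_span_singleton]
  rw [this]
  exact isClosed_le (by fun_prop) continuous_const

theorem PadicInt.tendsto_of_pow_dvd {x : ℕ → ℤ_[p]} {z : ℤ_[p]}
    (h : ∀ n, (p : ℤ_[p]) ^ n ∣ z - x n) : Filter.Tendsto x Filter.atTop (nhds z) := by
  have hp : (1 : ℝ) < p := by exact_mod_cast (Fact.out : p.Prime).one_lt
  rw [tendsto_iff_norm_sub_tendsto_zero]
  refine squeeze_zero (g := fun n : ℕ => ((p : ℝ)⁻¹) ^ n) (fun _ => norm_nonneg _) (fun n => ?_)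
    (tendsto_pow_atTop_nhds_zero_of_lt_one (by positivity) (inv_lt_one_of_one_lt₀ hp))
  have := (PadicInt.norm_le_pow_iff_mem_span_pow (z - x n) n).2 (Ideal.mem_span_singleton.2 (h n))
  rw [norm_sub_rev]
  simpa [zpow_neg] using this

/-- Every digit sequence is the expansion of a `p`-adic integer. -/
theorem exists_hasSum_digits (a : ℕ → Fin p) :
    ∃ z : ℤ_[p], HasSum (fun i : ℕ => ((a i : ℕ) : ℚ_[p]) * (p : ℚ_[p]) ^ i) z ∧
      ∀ n : ℕ, (p : ℤ_[p]) ^ n ∣ z - wordVal (List.ofFn fun i : Fin n => a i) := by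
  have hp : (1 : ℝ) < p := by exact_mod_cast (Fact.out : p.Prime).one_lt
  have hs : Summable (fun i : ℕ => ((a i : ℕ) : ℤ_[p]) * (p : ℤ_[p]) ^ i) := by
    refine Summable.of_norm_bounded (g := fun i : ℕ => ((p : ℝ)⁻¹) ^ i)
      (summable_geometric_of_lt_one (by positivity) (inv_lt_one_of_one_lt₀ hp)) fun i => ?_
    rw [norm_mul, norm_pow, PadicInt.norm_p]
    exact mul_le_of_le_one_left (by positivity) (PadicInt.norm_le_one _)
  refine ⟨_, hs.hasSum.map PadicInt.Coe.ringHom continuous_subtype_val, fun n => ?_⟩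
  refine (PadicInt.isClosed_pow_dvd n _).mem_of_tendsto hs.hasSum.tendsto_sum_nat ?_
  filter_upwards [Filter.eventually_ge_atTop n] with m hm
  rw [wordVal_ofFn]
  push_cast
  rw [← Finset.sum_range_add_sum_Ico _ hm, add_sub_cancel_left]
  exact Finset.dvd_sum fun i hi => Dvd.dvd.mul_left (pow_dvd_pow _ (Finset.mem_Ico.1 hi).1) _

theorem exists_prefix (n : ℕ) (x : ℤ_[p]) :
    ∃ w : List (Fin p), w.length = n ∧ (p : ℤ_[p]) ^ n ∣ x - wordVal w := by
  obtain ⟨w, hw, hv⟩ := exists_wordVal_eq n _ (x.appr_lt n)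
  exact ⟨w, hw, by rw [hv]; exact Ideal.mem_span_singleton.1 (x.appr_spec n)⟩

theorem prefix_unique {v w : List (Fin p)} (hl : v.length = w.length)
    (h : (p : ℤ_[p]) ^ w.length ∣ wordVal v - wordVal w) : v = w := by
  refine wordVal_injective hl ?_
  have h1 : (p ^ w.length : ℤ) ∣ (wordVal v : ℤ) - wordVal w := by
    rw [← PadicInt.pow_p_dvd_int_iff]
    push_cast
    exact h
  have h2 : wordVal w ≡ wordVal v [MOD p ^ w.length] := by
    rw [Nat.modEq_iff_dvd]
    exact_mod_cast h1
  exact (h2.eq_of_lt_of_lt (wordVal_lt w) (hl ▸ wordVal_lt v)).symm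

/-- If `v` and the longer word `w` are prefixes of the same `p`-adic integer, then `w` extends
`v`. -/
theorem exists_append_eq {v w : List (Fin p)} (hl : v.length ≤ w.length) {x : ℤ_[p]}
    (hv : (p : ℤ_[p]) ^ v.length ∣ x - wordVal v) (hw : (p : ℤ_[p]) ^ w.length ∣ x - wordVal w) :
    ∃ t, w = v ++ t := by
  refine ⟨w.drop v.length, ?_⟩
  conv_lhs => rw [← List.take_append_drop v.length w]
  congr 1
  refine prefix_unique (by simpa using hl) ?_
  have h1 : (wordVal w : ℤ_[p]) = wordVal (w.take v.length)
      + (p : ℤ_[p]) ^ v.length * wordVal (w.drop v.length) := by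
    conv_lhs => rw [← List.take_append_drop v.length w, wordVal_append]
    rw [List.length_take, min_eq_left hl]
    push_cast
    rfl
  have h2 := (pow_dvd_pow (p : ℤ_[p]) hl).trans hw
  rw [h1] at h2
  have := ((dvd_sub hv h2).add (dvd_mul_right ((p : ℤ_[p]) ^ v.length)
    (-(wordVal (w.drop v.length) : ℤ_[p]))))
  convert this using 1
  ring

theorem exists_digits (x : ℤ_[p]) :
    ∃ a : ℕ → Fin p, ∀ n, (p : ℤ_[p]) ^ n ∣ x - wordVal (List.ofFn fun i : Fin n => a i) := by
  choose w hl hw using fun n => exists_prefix n x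
  have hpos : 0 < p := (Fact.out : p.Prime).pos
  -- Prefixes of different lengths are compatible, so digit `n` can be read off the prefix of length
  -- `n + 1`; the default 0 never occurs.
  refine ⟨fun n => (w (n + 1)).getD n ⟨0, hpos⟩, fun n => ?_⟩
  suffices h : (List.ofFn fun i : Fin n => (w (i + 1)).getD i ⟨0, hpos⟩) = w n by
    rw [h]; exact hw n
  refine List.ext_getElem (by simp [hl]) fun i h1 h2 => ?_
  rw [List.length_ofFn] at h1
  obtain ⟨t, ht⟩ := exists_append_eq (v := w (i + 1)) (w := w n) (by rw [hl, hl]; omega)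
    (by rw [hl]; exact hw _) (by rw [hl]; exact hw _)
  have hi : i < (w (i + 1)).length := by rw [hl]; omega
  simp only [List.getElem_ofFn, ht, List.getElem_append_left hi]
  exact List.getD_eq_getElem _ _ hi

/-! ### The automaton of residuals -/

/-- The `p`-adic integers that lie in `X` when they are preceded by the digits `w`. -/
def wordResidual (X : Set ℤ_[p]) (w : List (Fin p)) : Set ℤ_[p] :=
  {y | (wordVal w : ℤ_[p]) + (p : ℤ_[p]) ^ w.length * y ∈ X}

theorem mem_wordResidual {X : Set ℤ_[p]} {w : List (Fin p)} {y : ℤ_[p]} :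
    y ∈ wordResidual X w ↔ (wordVal w : ℤ_[p]) + (p : ℤ_[p]) ^ w.length * y ∈ X := Iff.rfl

@[simp] theorem wordResidual_nil (X : Set ℤ_[p]) : wordResidual X [] = X := by
  ext y; simp [mem_wordResidual]

theorem wordResidual_append (X : Set ℤ_[p]) (v w : List (Fin p)) :
    wordResidual X (v ++ w) = wordResidual (wordResidual X v) w := by
  ext y
  simp only [mem_wordResidual, wordVal_append, List.length_append]
  push_cast
  ring_nf

theorem wordResidual_nonempty_iff {X : Set ℤ_[p]} {w : List (Fin p)} :
    (wordResidual X w).Nonempty ↔ ∃ x ∈ X, (p : ℤ_[p]) ^ w.length ∣ x - wordVal w := by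
  constructor
  · rintro ⟨y, hy⟩
    exact ⟨_, hy, by rw [add_sub_cancel_left]; exact dvd_mul_right _ _⟩
  · rintro ⟨x, hx, y, hy⟩
    exact ⟨y, by rw [mem_wordResidual, ← hy, add_sub_cancel]; exact hx⟩

theorem nonempty_of_wordResidual_nonempty {X : Set ℤ_[p]} {w : List (Fin p)}
    (h : (wordResidual X w).Nonempty) : X.Nonempty := let ⟨_, hy⟩ := h; ⟨_, hy⟩

/-- The nonempty residuals of `X`. -/
abbrev ResidualState (X : Set ℤ_[p]) : Type :=
  {Y : Set ℤ_[p] // Y.Nonempty ∧ ∃ w, Y = wordResidual X w}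

/-- The automaton of the nonempty residuals of `X`. -/
def residualAutomaton (X : Set ℤ_[p]) (hX : X.Nonempty) :
    PathAutomaton (Fin p) (ResidualState X) where
  trans := {t | t.2.2.1 = wordResidual t.1.1 [t.2.1]}
  init := ⟨X, hX, [], (wordResidual_nil X).symm⟩

variable {X : Set ℤ_[p]} {hX : X.Nonempty}

theorem residualAutomaton_isDeterministic : (residualAutomaton X hX).IsDeterministic :=
  fun _ _ _ _ h h' => Subtype.ext (Eq.trans h (Eq.symm h'))

theorem residualAutomaton_isPath_iff (q : ResidualState X) (w : List (Fin p))
    (r : ResidualState X) :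
    (residualAutomaton X hX).IsPath q w r ↔ r.1 = wordResidual q.1 w := by
  induction w generalizing q with
  | nil =>
    rw [wordResidual_nil]
    exact ⟨fun h => congrArg Subtype.val (Eq.symm h), fun h => (Subtype.ext h).symm⟩
  | cons a w ih =>
    have hcons : wordResidual q.1 (a :: w) = wordResidual (wordResidual q.1 [a]) w :=
      wordResidual_append _ [a] w
    constructor
    · rintro ⟨s, hs, hw⟩
      rw [hcons, ← show s.1 = wordResidual q.1 [a] from hs]
      exact (ih s).1 hw
    · intro h
      rw [hcons] at h
      obtain ⟨v, hv⟩ := q.2.2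
      refine ⟨⟨wordResidual q.1 [a], nonempty_of_wordResidual_nonempty (h ▸ r.2.1),
        v ++ [a], by rw [wordResidual_append, ← hv]⟩, rfl, (ih _).2 h⟩

theorem residualAutomaton_accepts_iff (w : List (Fin p)) :
    (residualAutomaton X hX).Accepts w ↔ (wordResidual X w).Nonempty := by
  constructor
  · rintro ⟨q, hq⟩
    have := (residualAutomaton_isPath_iff _ _ _).1 hq
    exact this ▸ q.2.1
  · exact fun h => ⟨⟨_, h, w, rfl⟩, (residualAutomaton_isPath_iff _ _ _).2 rfl⟩

theorem residualAutomaton_reach_iff (q r : ResidualState X) :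
    Relation.ReflTransGen (residualAutomaton X hX).Edge q r ↔ ∃ w, r.1 = wordResidual q.1 w := by
  simp only [← residualAutomaton_isPath_iff (hX := hX)]
  constructor
  · intro h
    induction h using Relation.ReflTransGen.head_induction_on with
    | refl => exact ⟨[], rfl⟩
    | head h _ ih =>
      obtain ⟨a, ha⟩ := h
      obtain ⟨w, hw⟩ := ih
      exact ⟨a :: w, _, ha, hw⟩
  · rintro ⟨w, hw⟩
    induction w generalizing q with
    | nil => exact Relation.ReflTransGen.refl.trans (by rw [show q = r from hw])
    | cons a w ih =>
      obtain ⟨s, hs, hw⟩ := hw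
      exact .head ⟨a, hs⟩ (ih s hw)

theorem mem_expansionLanguage_iff (a : ℕ → Fin p) :
    a ∈ expansionLanguage p ((↑) '' X : Set ℚ_[p]) ↔
      ∃ x ∈ X, ∀ n : ℕ, (p : ℤ_[p]) ^ n ∣ x - wordVal (List.ofFn fun i : Fin n => a i) := by
  obtain ⟨z, hz, hd⟩ := exists_hasSum_digits a
  constructor
  · rintro ⟨_, ⟨x, hx, rfl⟩, hs⟩
    obtain rfl : x = z := Subtype.ext (hs.unique hz)
    exact ⟨x, hx, hd⟩
  · rintro ⟨x, hx, h⟩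
    obtain rfl : x = z := PadicInt.eq_of_forall_pow_dvd_sub fun n => by
      simpa using dvd_sub (h n) (hd n)
    exact ⟨x, ⟨x, hx, rfl⟩, hz⟩

/-- If every prefix of `a` is shared by a point of `X`, these points converge to the sum of the
expansion, which lies in the closed set `X`. -/
theorem residualAutomaton_recognizes (hc : IsClosed X) :
    (residualAutomaton X hX).Recognizes (expansionLanguage p ((↑) '' X : Set ℚ_[p])) := by
  constructor
  · intro a
    simp only [PathAutomaton.AcceptsInf, residualAutomaton_accepts_iff, wordResidual_nonempty_iff,
      mem_expansionLanguage_iff, List.length_ofFn]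
    constructor
    · intro h
      choose x hx hd using h
      obtain ⟨z, -, hz⟩ := exists_hasSum_digits a
      refine ⟨z, hc.mem_of_tendsto (PadicInt.tendsto_of_pow_dvd (x := x) fun n => ?_)
        (Filter.Eventually.of_forall hx), hz⟩
      simpa using dvd_sub (hz n) (hd n)
    · rintro ⟨x, hx, h⟩ n
      exact ⟨x, hx, h n⟩
  · intro w
    simp only [residualAutomaton_accepts_iff, wordResidual_nonempty_iff, mem_expansionLanguage_iff]
    constructor
    · rintro ⟨x, hx, hd⟩
      obtain ⟨a, ha⟩ := exists_digits x
      refine ⟨a, ⟨x, hx, ha⟩, w.length, (prefix_unique (by simp) ?_).symm⟩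
      simpa using dvd_sub hd (ha w.length)
    · rintro ⟨a, ⟨x, hx, ha⟩, n, rfl⟩
      exact ⟨x, hx, by simpa using ha n⟩

end Padic

/-- If `q ≠ 1` is coprime to `D`, then the partial geometric sums of some even positive length are
divisible by `D`. -/
theorem exists_even_dvd_geom_sum {q : ℤ} {D : ℕ} (hD : D ≠ 0) (hq : q ≠ 1)
    (hcop : IsCoprime q D) :
    ∃ j : ℕ, j ≠ 0 ∧ Even j ∧ (D : ℤ) ∣ ∑ i ∈ Finset.range j, q ^ i := by
  -- The geometric sum times `q - 1` is `q ^ j - 1`, so it is enough that `q ^ j` be 1 modulo `D *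
  -- (q - 1)`, to which `q` is coprime. Twice the totient is an even such `j`.
  set m := (D * (q - 1)).natAbs with hm
  have hm0 : m ≠ 0 := by simpa [hm, sub_eq_zero, hD] using hq
  obtain ⟨a, b, hab⟩ : IsCoprime q (D * (q - 1)) := hcop.mul_right ⟨1, -1, by ring⟩
  have hmod : ((D * (q - 1) : ℤ) : ZMod m) = 0 :=
    (ZMod.intCast_zmod_eq_zero_iff_dvd _ _).2 (Int.natAbs_dvd.2 dvd_rfl)
  have hunit : IsUnit (q : ZMod m) := by
    have := congrArg (Int.cast : ℤ → ZMod m) hab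
    rw [Int.cast_add, Int.cast_mul b, hmod, mul_zero, add_zero, Int.cast_mul, Int.cast_one,
      mul_comm] at this
    exact IsUnit.of_mul_eq_one _ this
  obtain ⟨u, hu⟩ := hunit
  refine ⟨2 * m.totient, by simpa using hm0, even_two_mul _, ?_⟩
  have h1 : (D * (q - 1) : ℤ) ∣ q ^ (2 * m.totient) - 1 := by
    rw [← Int.natAbs_dvd, ← hm, ← ZMod.intCast_zmod_eq_zero_iff_dvd]
    push_cast
    rw [← hu, ← Units.val_pow_eq_pow_val, mul_comm 2, pow_mul, ZMod.pow_totient]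
    simp
  rw [← geom_sum_mul] at h1
  exact Int.dvd_of_mul_dvd_mul_right (sub_ne_zero.2 hq) h1

/-! ### Self-similar subsets of the `p`-adic integers -/

section SelfSimilar

variable {p : ℕ} [Fact p.Prime]

/-- Centrality keeps `wordVal v + r` between 0 and `p ^ v.length`, so adding `r` changes only the
digits of `v` and leaves the tail alone. -/
theorem exists_wordResidual_subset_of_translate {X Y : Set ℤ_[p]} {r : ℤ}
    (hY : ∀ x ∈ X, x + r ∈ Y) {v : List (Fin p)} (hv : IsCentralWord r.natAbs v) :
    ∃ u, wordResidual X v ⊆ wordResidual Y u := by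
  have hlt : (wordVal v : ℤ) < (p : ℤ) ^ v.length := by exact_mod_cast wordVal_lt v
  have h0 : 0 ≤ (wordVal v : ℤ) + r := by
    by_contra! hneg
    refine hv (wordVal v) ?_ (by simp)
    rw [← Int.abs_eq_natAbs, abs_of_nonneg (by positivity)]
    have := neg_le_abs r
    linarith
  have h1 : (wordVal v : ℤ) + r < (p : ℤ) ^ v.length := by
    by_contra! hge
    refine hv (wordVal v - (p : ℤ) ^ v.length) ?_ (by simp)
    rw [← Int.abs_eq_natAbs, abs_le]
    have := le_abs_self r
    constructor <;> linarith
  obtain ⟨c, hc⟩ := Int.eq_ofNat_of_zero_le h0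
  obtain ⟨u, hu, hval⟩ := exists_wordVal_eq (p := p) v.length c
    (by rw [hc] at h1; exact_mod_cast h1)
  refine ⟨u, fun y hy => ?_⟩
  rw [mem_wordResidual, hval, hu]
  have := congrArg (Int.cast : ℤ → ℤ_[p]) hc
  push_cast at this
  convert hY _ hy using 1
  linear_combination -this

/-- `X` is the union of its images under the maps `x ↦ σ i * p ^ k i * x + δ i`, where `σ i = ±1`,
`k i ≥ 1`, and `D * δ i` is the integer `e i`, with `D` prime to `p`. -/
structure IsSelfSimilar {ι : Type*} (X : Set ℤ_[p]) (σ : ι → ℤ) (k : ι → ℕ) (δ : ι → ℤ_[p])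
    (D : ℕ) (e : ι → ℤ) : Prop where
  sign : ∀ i, σ i = 1 ∨ σ i = -1
  one_le : ∀ i, 1 ≤ k i
  coprime : D.Coprime p
  mul_eq : ∀ i, (D : ℤ_[p]) * δ i = e i
  mem_iff : ∀ x, x ∈ X ↔ ∃ i, ∃ y ∈ X, x = (σ i : ℤ_[p]) * (p : ℤ_[p]) ^ k i * y + δ i

namespace IsSelfSimilar

variable {ι : Type*} {X : Set ℤ_[p]} {σ : ι → ℤ} {k : ι → ℕ} {δ : ι → ℤ_[p]} {D : ℕ} {e : ι → ℤ}

theorem ne_zero (h : IsSelfSimilar X σ k δ D e) : D ≠ 0 := by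
  rintro rfl
  exact (Fact.out : p.Prime).one_lt.ne' (by simpa using h.coprime)

/-- The affine image of `X` under `x ↦ s * p ^ m * x + N / D`. -/
def affinePiece (X : Set ℤ_[p]) (D : ℕ) (s : ℤ) (m : ℕ) (N : ℤ) : Set ℤ_[p] :=
  {y | ∃ x ∈ X, (D : ℤ_[p]) * y = D * s * (p : ℤ_[p]) ^ m * x + N}

theorem mem_wordResidual_singleton {Y : Set ℤ_[p]} {a : Fin p} {y : ℤ_[p]} :
    y ∈ wordResidual Y [a] ↔ ((a : ℕ) : ℤ_[p]) + p * y ∈ Y := by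
  simp [mem_wordResidual]

/-- The union has at most one term; it is empty when `p` does not divide `N - D * a`. -/
theorem wordResidual_affinePiece_succ (s : ℤ) (m : ℕ) (N : ℤ) (a : Fin p) :
    wordResidual (affinePiece X D s (m + 1) N) [a] =
      ⋃ N' ∈ {N' : ℤ | N = D * (a : ℕ) + p * N'}, affinePiece X D s m N' := by
  have hp : (p : ℤ_[p]) ≠ 0 := by exact_mod_cast (Fact.out : p.Prime).ne_zero
  ext y
  simp only [mem_wordResidual_singleton, affinePiece, Set.mem_iUnion, Set.mem_ofPred_eq,
    exists_prop]
  constructor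
  · rintro ⟨x, hx, h⟩
    have hd : (p : ℤ_[p]) ^ 1 ∣ ((N - D * (a : ℕ) : ℤ) : ℤ_[p]) :=
      ⟨D * y - D * s * (p : ℤ_[p]) ^ m * x, by push_cast; linear_combination -h⟩
    rw [PadicInt.pow_p_dvd_int_iff, pow_one] at hd
    obtain ⟨N', hN'⟩ := hd
    obtain rfl : N = D * (a : ℕ) + p * N' := by linarith
    refine ⟨N', rfl, x, hx, mul_left_cancel₀ hp ?_⟩
    push_cast at h
    linear_combination h
  · rintro ⟨N', rfl, x, hx, h⟩
    refine ⟨x, hx, ?_⟩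
    push_cast
    linear_combination p * h

/-- When no power of `p` is left to absorb a digit, unfolding `X` once supplies new ones. -/
theorem affinePiece_zero (h : IsSelfSimilar X σ k δ D e) (s : ℤ) (N : ℤ) :
    affinePiece X D s 0 N = ⋃ i, affinePiece X D (s * σ i) (k i) (N + s * e i) := by
  ext y
  simp only [affinePiece, Set.mem_iUnion, Set.mem_ofPred_eq]
  constructor
  · rintro ⟨x, hx, hy⟩
    obtain ⟨i, z, hz, rfl⟩ := (h.mem_iff x).1 hx
    refine ⟨i, z, hz, ?_⟩
    push_cast
    linear_combination hy + s * h.mul_eq i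
  · rintro ⟨i, z, hz, hy⟩
    refine ⟨_, (h.mem_iff _).2 ⟨i, z, hz, rfl⟩, ?_⟩
    push_cast at hy
    linear_combination hy - s * h.mul_eq i

theorem wordResidual_iUnion {κ : Sort*} (Y : κ → Set ℤ_[p]) (w : List (Fin p)) :
    wordResidual (⋃ i, Y i) w = ⋃ i, wordResidual (Y i) w := by
  ext y; simp [mem_wordResidual]

/-- The affine pieces whose parameters lie within the given bounds. -/
def boundedPieces (X : Set ℤ_[p]) (D m B : ℕ) : Set (Set ℤ_[p]) :=
  {Y | ∃ s : ℤ, (s = 1 ∨ s = -1) ∧ ∃ l ≤ m, ∃ N : ℤ, |N| ≤ B ∧ Y = affinePiece X D s l N}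

theorem finite_boundedPieces (X : Set ℤ_[p]) (D m B : ℕ) : (boundedPieces X D m B).Finite := by
  refine ((({1, -1} : Set ℤ).toFinite.prod ((Set.finite_Iic m).prod
    (Set.finite_Icc (-(B : ℤ)) B))).image fun t => affinePiece X D t.1 t.2.1 t.2.2).subset ?_
  rintro _ ⟨s, hs, l, hl, N, hN, rfl⟩
  exact ⟨(s, l, N), ⟨hs, hl, abs_le.1 hN⟩, rfl⟩

/-- The bound B = `E + 2 * D` is preserved: unfolding adds at most `E` to |N|, and removing a digit
then gives |N'| ≤ (E + B + Dp)/p ≤ B because p ≥ 2. -/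
theorem exists_wordResidual_succ_eq {s : ℤ} (hs : s = 1 ∨ s = -1) {l m E : ℕ} (hl : l < m)
    {N : ℤ} (hN : |N| ≤ (E + (E + 2 * D) : ℕ)) (a : Fin p) :
    ∃ 𝒰 ⊆ boundedPieces X D m (E + 2 * D),
      wordResidual (affinePiece X D s (l + 1) N) [a] = ⋃₀ 𝒰 := by
  refine ⟨{Y | ∃ N' : ℤ, N = D * (a : ℕ) + p * N' ∧ Y = affinePiece X D s l N'}, ?_, ?_⟩
  · rintro _ ⟨N', rfl, rfl⟩
    refine ⟨s, hs, l, hl.le, N', ?_, rfl⟩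
    have hp : (2 : ℤ) ≤ p := by exact_mod_cast (Fact.out : p.Prime).two_le
    have ha : ((a : ℕ) : ℤ) ≤ p := by exact_mod_cast a.2.le
    have ha0 : (0 : ℤ) ≤ ((a : ℕ) : ℤ) := by positivity
    have hE : (0 : ℤ) ≤ E := by positivity
    have hD : (0 : ℤ) ≤ D := by positivity
    rw [abs_le] at hN ⊢
    push_cast at hN ⊢
    have h1 : (D : ℤ) * (a : ℕ) ≤ D * p := mul_le_mul_of_nonneg_left ha hD
    have h2 : 0 ≤ (D : ℤ) * (a : ℕ) := by positivity
    have h3 : 0 ≤ (E + D : ℤ) * (p - 2) := mul_nonneg (by positivity) (by linarith)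
    constructor
    · refine le_of_mul_le_mul_left (a := (p : ℤ)) ?_ (by linarith)
      nlinarith
    · refine le_of_mul_le_mul_left (a := (p : ℤ)) ?_ (by linarith)
      nlinarith
  · rw [wordResidual_affinePiece_succ]
    ext y
    simp only [Set.mem_iUnion, Set.mem_sUnion, Set.mem_ofPred_eq]
    constructor
    · rintro ⟨N', hN', hy⟩
      exact ⟨_, ⟨N', hN', rfl⟩, hy⟩
    · rintro ⟨_, ⟨N', hN', rfl⟩, hy⟩
      exact ⟨N', hN', hy⟩

/-- Removing a digit turns a bounded piece into a union of bounded pieces, so every residual is the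
union of a subfamily of one finite family. -/
theorem finite_wordResiduals [Finite ι] (h : IsSelfSimilar X σ k δ D e) :
    {Y | ∃ w, Y = wordResidual X w}.Finite := by
  obtain ⟨m, hm⟩ := (Set.finite_range k).bddAbove
  obtain ⟨E, hE⟩ := (Set.finite_range fun i => (e i).natAbs).bddAbove
  have hk : ∀ i, k i ≤ m := fun i => hm ⟨i, rfl⟩
  have he : ∀ i, |e i| ≤ E := fun i => by
    rw [Int.abs_eq_natAbs]; exact_mod_cast hE ⟨i, rfl⟩
  set 𝓕 := boundedPieces X D m (E + 2 * D)
  have letter : ∀ Y ∈ 𝓕, ∀ a, ∃ 𝒰 ⊆ 𝓕, wordResidual Y [a] = ⋃₀ 𝒰 := by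
    rintro _ ⟨s, hs, l, hl, N, hN, rfl⟩ a
    have hE0 : (0 : ℤ) ≤ E := by positivity
    obtain _ | l := l
    · have hpiece : ∀ i, ∃ 𝒰 ⊆ 𝓕,
          wordResidual (affinePiece X D (s * σ i) (k i) (N + s * e i)) [a] = ⋃₀ 𝒰 := by
        intro i
        obtain ⟨l, hl⟩ : ∃ l, k i = l + 1 := ⟨k i - 1, by have := h.one_le i; omega⟩
        rw [hl]
        refine exists_wordResidual_succ_eq ?_ (by have := hk i; omega) ?_ a
        · rcases hs with rfl | rfl <;> rcases h.sign i with h1 | h1 <;> simp [h1]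
        · have hse : |s * e i| = |e i| := by rcases hs with rfl | rfl <;> simp
          have := abs_add_le N (s * e i)
          have := he i
          push_cast at hN ⊢
          linarith
      choose 𝒰 h𝒰 hU using hpiece
      refine ⟨⋃ i, 𝒰 i, Set.iUnion_subset h𝒰, ?_⟩
      rw [h.affinePiece_zero, wordResidual_iUnion, Set.sUnion_iUnion]
      exact Set.iUnion_congr hU
    · exact exists_wordResidual_succ_eq hs (by omega) (by push_cast at hN ⊢; linarith) a
  refine ((finite_boundedPieces X D m (E + 2 * D)).powerset.image Set.sUnion).subset ?_
  rintro _ ⟨w, rfl⟩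
  induction w using List.reverseRecOn with
  | nil =>
    refine ⟨{X}, ?_, by rw [Set.sUnion_singleton, wordResidual_nil]⟩
    rw [Set.mem_powerset_iff, Set.singleton_subset_iff]
    refine ⟨1, .inl rfl, 0, zero_le, 0, by simpa using by positivity, ?_⟩
    have hD : (D : ℤ_[p]) ≠ 0 := by exact_mod_cast h.ne_zero
    ext y
    simp [affinePiece, hD]
  | append_singleton w a ih =>
    obtain ⟨𝒰, h𝒰, hU⟩ := ih
    choose! 𝒱 h𝒱 hV using letter
    refine ⟨⋃ Y ∈ 𝒰, 𝒱 Y a, Set.iUnion₂_subset fun Y hY => h𝒱 Y (h𝒰 hY) a, ?_⟩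
    rw [wordResidual_append, ← hU, Set.sUnion_eq_biUnion (s := 𝒰)]
    simp only [wordResidual_iUnion, Set.sUnion_iUnion]
    exact Set.iUnion₂_congr fun Y hY => (hV Y (h𝒰 hY) a).symm

/-! ### Contractions of `X` into itself and central words -/

/-- Every point of `X` lies in an image of `X` under an arbitrarily strong contraction. -/
theorem exists_mapsTo (h : IsSelfSimilar X σ k δ D e) {x : ℤ_[p]} (hx : x ∈ X) (n : ℕ) :
    ∃ s : ℤ, (s = 1 ∨ s = -1) ∧ ∃ l ≥ n, ∃ d : ℤ_[p], (∃ N : ℤ, (D : ℤ_[p]) * d = N) ∧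
      (∀ z ∈ X, (s : ℤ_[p]) * (p : ℤ_[p]) ^ l * z + d ∈ X) ∧ (p : ℤ_[p]) ^ n ∣ x - d := by
  -- The induction must keep `x` as the image of a point of `X`, so that this point can be unfolded
  -- again.
  suffices H : ∃ s : ℤ, (s = 1 ∨ s = -1) ∧ ∃ l ≥ n, ∃ d : ℤ_[p], (∃ N : ℤ, (D : ℤ_[p]) * d = N) ∧
      (∀ z ∈ X, (s : ℤ_[p]) * (p : ℤ_[p]) ^ l * z + d ∈ X) ∧
      ∃ y ∈ X, x = (s : ℤ_[p]) * (p : ℤ_[p]) ^ l * y + d by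
    obtain ⟨s, hs, l, hl, d, hd, hm, y, -, rfl⟩ := H
    refine ⟨s, hs, l, hl, d, hd, hm, ?_⟩
    rw [add_sub_cancel_right]
    exact Dvd.dvd.mul_right (Dvd.dvd.mul_left (pow_dvd_pow _ hl) _) _
  induction n with
  | zero => exact ⟨1, .inl rfl, 0, le_rfl, 0, ⟨0, by simp⟩, by simp, x, hx, by simp⟩
  | succ n ih =>
    obtain ⟨s, hs, l, hl, d, ⟨N, hN⟩, hm, y, hy, rfl⟩ := ih
    obtain ⟨i, z, hz, rfl⟩ := (h.mem_iff y).1 hy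
    have h1 := h.one_le i
    refine ⟨s * σ i, ?_, l + k i, by omega, s * (p : ℤ_[p]) ^ l * δ i + d,
      ⟨s * (p : ℤ) ^ l * e i + N, ?_⟩, fun t ht => ?_, z, hz, ?_⟩
    · rcases hs with rfl | rfl <;> rcases h.sign i with h1 | h1 <;> simp [h1]
    · push_cast
      linear_combination hN + s * (p : ℤ_[p]) ^ l * h.mul_eq i
    · convert hm _ ((h.mem_iff _).2 ⟨i, t, ht, rfl⟩) using 1
      push_cast; ring
    · push_cast; ring

/-- Iterating z ↦ qz + d gives q^j z + d(1 + q + … + q^(j-1)). An even j removes the sign, and a sum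
divisible by `D` makes the shift an integer. The shift stays congruent to d modulo q, hence close to
`x`. -/
theorem exists_mapsTo_int (h : IsSelfSimilar X σ k δ D e) {x : ℤ_[p]} (hx : x ∈ X) (n : ℕ) :
    ∃ l ≥ n, ∃ c : ℤ, (∀ z ∈ X, (p : ℤ_[p]) ^ l * z + c ∈ X) ∧ (p : ℤ_[p]) ^ n ∣ x - c := by
  -- Asking for `n + 1` forces `l ≥ 1`, hence `q ≠ 1`.
  obtain ⟨s, hs, l, hl, d, ⟨N, hN⟩, hm, hd⟩ := h.exists_mapsTo hx (n + 1)
  have hp : (1 : ℤ) < p := by exact_mod_cast (Fact.out : p.Prime).one_lt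
  have hpl : (1 : ℤ) < (p : ℤ) ^ l := one_lt_pow₀ hp (by omega)
  set q : ℤ := s * (p : ℤ) ^ l with hq
  have hq1 : q ≠ 1 := by
    rcases hs with rfl | rfl
    · rw [hq]; linarith
    · rw [hq]; linarith
  have hcop : IsCoprime q D := by
    refine IsCoprime.mul_left ?_ (IsCoprime.pow_left ?_)
    · rcases hs with rfl | rfl
      · exact isCoprime_one_left
      · exact isCoprime_one_left.neg_left
    · exact (Nat.isCoprime_iff_coprime.2 h.coprime).symm
  obtain ⟨j, hj0, hj, t, ht⟩ := exists_even_dvd_geom_sum h.ne_zero hq1 hcop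
  have hiter : ∀ (i : ℕ), ∀ z ∈ X,
      (q : ℤ_[p]) ^ i * z + d * ∑ r ∈ Finset.range i, (q : ℤ_[p]) ^ r ∈ X := by
    intro i
    induction i with
    | zero => intro z hz; simpa using hz
    | succ i ih =>
      intro z hz
      convert hm _ (ih z hz) using 1
      rw [geom_sum_succ, hq]
      push_cast
      ring
  have hsum : d * ∑ r ∈ Finset.range j, (q : ℤ_[p]) ^ r = ((N * t : ℤ) : ℤ_[p]) := by
    have : ∑ r ∈ Finset.range j, (q : ℤ_[p]) ^ r = D * t := by exact_mod_cast congrArg Int.cast ht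
    rw [this]
    push_cast
    linear_combination t * hN
  refine ⟨l * j, le_trans (by omega) (Nat.le_mul_of_pos_right l (Nat.pos_of_ne_zero hj0)), N * t,
    fun z hz => ?_, ?_⟩
  · have := hiter j z hz
    rw [hsum] at this
    convert this using 2
    have hsj : (s : ℤ_[p]) ^ j = 1 := by rcases hs with rfl | rfl <;> simp [hj]
    rw [hq]
    push_cast
    rw [mul_pow, hsj, pow_mul, one_mul]
  · obtain ⟨i, rfl⟩ := Nat.exists_eq_succ_of_ne_zero hj0
    rw [← hsum, geom_sum_succ]
    have h1 : (p : ℤ_[p]) ^ n ∣ q := by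
      rw [hq]; push_cast
      exact Dvd.dvd.mul_left (pow_dvd_pow _ (by omega)) _
    have h2 := dvd_sub ((pow_dvd_pow (p : ℤ_[p]) n.le_succ).trans hd)
      (h1.mul_right (d * ∑ r ∈ Finset.range i, (q : ℤ_[p]) ^ r))
    convert h2 using 1
    ring

/-- Every nonempty residual has a residual that contains an integer translate of `X`. -/
theorem exists_translate_subset (h : IsSelfSimilar X σ k δ D e) {w : List (Fin p)}
    (hw : (wordResidual X w).Nonempty) :
    ∃ (t : List (Fin p)) (r : ℤ), ∀ x ∈ X, x + r ∈ wordResidual X (w ++ t) := by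
  obtain ⟨x, hx, hd⟩ := wordResidual_nonempty_iff.1 hw
  obtain ⟨l, hl, c, hm, hc⟩ := h.exists_mapsTo_int hx w.length
  -- Since `c` is an integer, so is the quotient `r` left after removing its first `l` digits, and
  -- `X + r` lies in the residual along them.
  obtain ⟨v, hv, hcv⟩ := exists_prefix l (c : ℤ_[p])
  have hwc : (p : ℤ_[p]) ^ w.length ∣ c - wordVal w := by
    simpa using dvd_sub hd hc
  obtain ⟨t, rfl⟩ := exists_append_eq (hv ▸ hl) hwc (hv ▸ hcv)
  have hr : (p : ℤ_[p]) ^ l ∣ ((c - wordVal (w ++ t) : ℤ) : ℤ_[p]) := by push_cast; exact hcv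
  rw [PadicInt.pow_p_dvd_int_iff] at hr
  obtain ⟨r, hr⟩ := hr
  refine ⟨t, r, fun z hz => ?_⟩
  rw [mem_wordResidual, hv]
  convert hm z hz using 1
  have := congrArg (Int.cast : ℤ → ℤ_[p]) hr
  push_cast at this
  linear_combination -this

/-- A residual contains a translate of `X`, so infinitely many points of `X` start with `w`. One of
them is none of the finitely many integers of absolute value at most `R`, and a long enough prefix
of it tells it apart from them all. -/
theorem exists_isCentralWord (h : IsSelfSimilar X σ k δ D e) (hX : X.Infinite) (R : ℕ)
    {w : List (Fin p)} (hw : (wordResidual X w).Nonempty) :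
    ∃ t, (wordResidual X (w ++ t)).Nonempty ∧ IsCentralWord R (w ++ t) := by
  obtain ⟨t, r, ht⟩ := h.exists_translate_subset hw
  have hp : (p : ℤ_[p]) ≠ 0 := by exact_mod_cast (Fact.out : p.Prime).ne_zero
  have hinj : Function.Injective fun z : ℤ_[p] =>
      (wordVal (w ++ t) : ℤ_[p]) + (p : ℤ_[p]) ^ (w ++ t).length * (z + r) := by
    intro y z hyz
    have := mul_left_cancel₀ (pow_ne_zero _ hp) (add_left_cancel hyz)
    exact add_right_cancel this
  obtain ⟨_, ⟨z, hz, rfl⟩, hnot⟩ := (hX.image hinj.injOn).exists_notMem_finite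
    ((Set.finite_Icc (-(R : ℤ)) R).image (Int.cast : ℤ → ℤ_[p]))
  set x := (wordVal (w ++ t) : ℤ_[p]) + (p : ℤ_[p]) ^ (w ++ t).length * (z + r) with hxdef
  have hx : x ∈ X := ht z hz
  have hex : ∀ m : ℤ, |m| ≤ R → ∃ n : ℕ, ¬ (p : ℤ_[p]) ^ n ∣ x - m := by
    intro m hm
    by_contra! hall
    exact hnot ⟨m, abs_le.1 hm, (PadicInt.eq_of_forall_pow_dvd_sub hall).symm⟩
  choose! f hf using hex
  obtain ⟨n, hn⟩ := ((Set.finite_Icc (-(R : ℤ)) R).image f).bddAbove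
  obtain ⟨v, hv, hxv⟩ := exists_prefix (w.length + n) x
  have hxw : (p : ℤ_[p]) ^ w.length ∣ x - wordVal w := by
    rw [hxdef, wordVal_append, List.length_append, pow_add]
    refine ⟨wordVal t + p ^ t.length * (z + r), ?_⟩
    push_cast
    ring
  obtain ⟨u, rfl⟩ := exists_append_eq (by omega) hxw (hv ▸ hxv)
  refine ⟨u, wordResidual_nonempty_iff.2 ⟨x, hx, hv ▸ hxv⟩, fun m hm hd => hf m hm ?_⟩
  have hfm : f m ≤ w.length + n := (hn ⟨m, abs_le.1 hm, rfl⟩).trans (Nat.le_add_left _ _)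
  rw [hv, ← PadicInt.pow_p_dvd_int_iff] at hd
  refine (pow_dvd_pow _ hfm).trans ?_
  have := dvd_add hxv hd
  push_cast at this
  convert this using 1
  ring

/-- Contractions carry two distinct points to distinct points of `X` arbitrarily close together,
which a finite set does not allow. -/
theorem infinite_of_not_subsingleton (h : IsSelfSimilar X σ k δ D e)
    (hX : ¬ X.Subsingleton) : X.Infinite := by
  obtain ⟨x, hx, y, hy, hxy⟩ := Set.not_subsingleton_iff.1 hX
  have key : ∀ n : ℕ, ∃ x ∈ X, ∃ y ∈ X, x ≠ y ∧ (p : ℤ_[p]) ^ n ∣ x - y := by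
    intro n
    obtain ⟨l, hl, c, hm, -⟩ := h.exists_mapsTo_int hx n
    have hp : (p : ℤ_[p]) ≠ 0 := by exact_mod_cast (Fact.out : p.Prime).ne_zero
    refine ⟨_, hm x hx, _, hm y hy, fun heq => hxy ?_, ?_⟩
    · exact mul_left_cancel₀ (pow_ne_zero _ hp) (add_right_cancel heq)
    · exact (pow_dvd_pow _ hl).trans ⟨x - y, by ring⟩
  intro hfin
  have hex : ∀ t : ℤ_[p] × ℤ_[p], t.1 ≠ t.2 → ∃ n : ℕ, ¬ (p : ℤ_[p]) ^ n ∣ t.1 - t.2 := by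
    intro t ht
    by_contra! hall
    exact ht (PadicInt.eq_of_forall_pow_dvd_sub hall)
  choose! f hf using hex
  obtain ⟨n, hn⟩ := ((hfin.prod hfin).image f).bddAbove
  obtain ⟨x, hx, y, hy, hne, hd⟩ := key n
  exact hf (x, y) hne ((pow_dvd_pow _ (hn ⟨(x, y), ⟨hx, hy⟩, rfl⟩)).trans hd)

/-! ### A state reachable from every state -/

theorem exists_forall_reach [Finite ι] (h : IsSelfSimilar X σ k δ D e)
    (hX : X.Nonempty) :
    ∃ S, ∀ q, Relation.ReflTransGen (residualAutomaton X hX).Edge q S := by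
  have : Finite (ResidualState X) :=
    (h.finite_wordResiduals.subset fun Y hY => hY.2).to_subtype
  set E := (residualAutomaton X hX).Edge with hE
  by_cases hsub : X.Subsingleton
  · obtain ⟨z, rfl⟩ := hsub.eq_empty_or_singleton.resolve_left hX.ne_empty
    obtain ⟨S, -, hS⟩ := exists_recurrent E (residualAutomaton {z} hX).init
    refine ⟨S, fun q => ?_⟩
    obtain ⟨v, hv⟩ := S.2.2
    obtain ⟨w, hw⟩ := q.2.2
    have hzv : (p : ℤ_[p]) ^ v.length ∣ z - wordVal v := by
      obtain ⟨_, rfl, hd⟩ := wordResidual_nonempty_iff.1 (hv ▸ S.2.1)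
      exact hd
    have hzw : (p : ℤ_[p]) ^ w.length ∣ z - wordVal w := by
      obtain ⟨_, rfl, hd⟩ := wordResidual_nonempty_iff.1 (hw ▸ q.2.1)
      exact hd
    obtain ⟨u, hu, hzu⟩ := exists_prefix (v.length + w.length) z
    rw [← hu] at hzu
    obtain ⟨s, hs⟩ := exists_append_eq (by omega) hzv hzu
    obtain ⟨t, ht⟩ := exists_append_eq (by omega) hzw hzu
    let U : ResidualState {z} := ⟨wordResidual {z} u,
      wordResidual_nonempty_iff.2 ⟨z, rfl, hzu⟩, u, rfl⟩
    have hSU : Relation.ReflTransGen E S U :=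
      (residualAutomaton_reach_iff _ _).2 ⟨s, by rw [hv, ← wordResidual_append, ← hs]⟩
    have hqU : Relation.ReflTransGen E q U :=
      (residualAutomaton_reach_iff _ _).2 ⟨t, by rw [hw, ← wordResidual_append, ← ht]⟩
    exact hqU.trans (hS U hSU)
  · have hinf := h.infinite_of_not_subsingleton hsub
    obtain ⟨S₀, -, hS₀⟩ := exists_recurrent E (residualAutomaton X hX).init
    obtain ⟨S, hS, hmax⟩ := (Set.toFinite {r : ResidualState X | ∀ s,
      Relation.ReflTransGen E r s → Relation.ReflTransGen E s r}).exists_maximal ⟨S₀, hS₀⟩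
    refine ⟨S, fun q => ?_⟩
    obtain ⟨q', hqq', hq'⟩ := exists_recurrent E q
    obtain ⟨w, hw⟩ := q'.2.2
    obtain ⟨t, r, htr⟩ := h.exists_translate_subset (hw ▸ q'.2.1)
    obtain ⟨v, hv⟩ := S.2.2
    obtain ⟨v₁, hne, hcentral⟩ := h.exists_isCentralWord hinf r.natAbs (hv ▸ S.2.1)
    -- Recurrence of `S` closes the detour through the central word, so `S` itself is the residual
    -- along a central word.
    have hback := hS ⟨_, hne, _, rfl⟩
      ((residualAutomaton_reach_iff _ _).2 ⟨v₁, by rw [hv, ← wordResidual_append]⟩)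
    obtain ⟨v₂, hv₂⟩ := (residualAutomaton_reach_iff _ _).1 hback
    dsimp only at hv₂
    rw [← wordResidual_append] at hv₂
    obtain ⟨u, hu⟩ := exists_wordResidual_subset_of_translate htr (hcentral.append v₂)
    rw [← hv₂, ← wordResidual_append] at hu
    let T : ResidualState X := ⟨wordResidual X (w ++ t ++ u), S.2.1.mono hu, _, rfl⟩
    have hq'T : Relation.ReflTransGen E q' T :=
      (residualAutomaton_reach_iff _ _).2 ⟨t ++ u, by
        rw [hw, ← wordResidual_append, ← List.append_assoc]⟩
    have hT : ∀ s, Relation.ReflTransGen E T s → Relation.ReflTransGen E s T :=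
      fun s hs => (hq' s (hq'T.trans hs)).trans hq'T
    -- `T` contains `S` and is recurrent, being reachable from the recurrent state `q'`.
    have hTS : T = S := le_antisymm (hmax hT hu) hu
    exact hTS ▸ hqq'.trans hq'T

end IsSelfSimilar

/-! ### From the attractor to a self-similar set of `p`-adic integers -/

/-- Look at a point of maximal norm: if that norm exceeded 1, it would be at most 1/p times the norm
of a preimage in `K`, which is no larger than the maximum. -/
theorem norm_le_one_of_isAttractor {ι : Type*} {σ : ι → ℤ} {k : ι → ℕ} (hk : ∀ i, 1 ≤ k i)
    {d : ι → ℚ_[p]} (hd : ∀ i, ‖d i‖ ≤ 1) {K : Set ℚ_[p]}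
    (hK : IsAttractor (fun i x => (σ i : ℚ_[p]) * (p : ℚ_[p]) ^ k i * x + d i) K) :
    ∀ x ∈ K, ‖x‖ ≤ 1 := by
  obtain ⟨hne, hc, hU⟩ := hK
  have hp : (1 : ℝ) < p := by exact_mod_cast (Fact.out : p.Prime).one_lt
  obtain ⟨x, hx, hmax⟩ := hc.exists_isMaxOn hne continuous_norm.continuousOn
  suffices hx1 : ‖x‖ ≤ 1 from fun y hy => (hmax hy).trans hx1
  rw [hU] at hx
  obtain ⟨i, y, hy, rfl⟩ := Set.mem_iUnion.1 hx
  by_contra! hgt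
  dsimp only at hgt hmax
  have h1 : ‖(σ i : ℚ_[p]) * (p : ℚ_[p]) ^ k i * y‖ ≤ (p : ℝ)⁻¹ * ‖y‖ := by
    rw [norm_mul, norm_mul, norm_pow, Padic.norm_p]
    refine mul_le_mul_of_nonneg_right ?_ (norm_nonneg _)
    have h2 : ((p : ℝ)⁻¹) ^ k i ≤ (p : ℝ)⁻¹ :=
      pow_le_of_le_one (by positivity) (inv_le_one_of_one_le₀ hp.le) (by have := hk i; omega)
    calc _ ≤ 1 * ((p : ℝ)⁻¹) ^ k i :=
          mul_le_mul_of_nonneg_right (Padic.norm_int_le_one _) (by positivity)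
      _ ≤ _ := by rwa [one_mul]
  have h3 := Padic.nonarchimedean ((σ i : ℚ_[p]) * (p : ℚ_[p]) ^ k i * y) (d i)
  have h4 : ‖y‖ ≤ ‖(σ i : ℚ_[p]) * (p : ℚ_[p]) ^ k i * y + d i‖ := hmax hy
  rcases le_max_iff.1 h3 with h5 | h5
  · have h6 : (p : ℝ)⁻¹ < 1 := inv_lt_one_of_one_lt₀ hp
    have h7 : 0 < ‖y‖ := by
      by_contra! h8
      have : ‖y‖ = 0 := le_antisymm h8 (norm_nonneg _)
      rw [this, mul_zero] at h1
      linarith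
    nlinarith
  · linarith [hd i]

end SelfSimilar

theorem theorem5p4 (p : ℕ) [Fact p.Prime] {ι : Type*} [Finite ι] [Nonempty ι]
    (b : ι → Fin 2) (k : ι → ℕ) (hk : ∀ i, 1 ≤ k i)
    (d : ι → ℚ) (hd : ∀ i, ‖((d i : ℚ) : ℚ_[p])‖ ≤ 1)
    (K : Set ℚ_[p])
    (hK : IsAttractor
      (fun i (x : ℚ_[p]) => (-1) ^ (b i : ℕ) * (p : ℚ_[p]) ^ k i * x + ((d i : ℚ) : ℚ_[p])) K) :
    ∃ (Q : Type) (_ : Finite Q) (M : PathAutomaton (Fin p) Q),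
      M.IsDeterministic ∧ M.Recognizes (expansionLanguage p K) ∧
        ∃! C : Set Q, M.IsEssentialClass C := by
  have hK' : IsAttractor (fun i x => (((-1) ^ (b i : ℕ) : ℤ) : ℚ_[p]) * (p : ℚ_[p]) ^ k i * x
      + ((d i : ℚ) : ℚ_[p])) K := by
    push_cast
    exact hK
  have hint := norm_le_one_of_isAttractor hk hd hK'
  obtain ⟨hne, hc, hU⟩ := hK'
  set X : Set ℤ_[p] := (↑) ⁻¹' K
  have himage : ((↑) '' X : Set ℚ_[p]) = K :=
    Set.image_preimage_eq_of_subset fun x hx => ⟨⟨x, hint x hx⟩, rfl⟩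
  have hX : X.Nonempty := by
    rw [← himage] at hne
    exact hne.of_image
  have hclosed : IsClosed X := hc.isClosed.preimage continuous_subtype_val
  have := Fintype.ofFinite ι
  have hden : ∀ i, ∃ e : ℤ, ((∏ j, (d j).den : ℕ) : ℚ) * d i = e := by
    intro i
    obtain ⟨t, ht⟩ := Finset.dvd_prod_of_mem (fun j => (d j).den) (Finset.mem_univ i)
    refine ⟨t * (d i).num, ?_⟩
    rw [ht]
    push_cast
    linear_combination (t : ℚ) * Rat.den_mul_eq_num (d i)
  choose e he using hden
  -- The product of the denominators serves as `D`; it is prime to `p` because every `d i` is a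
  -- `p`-adic integer.
  have hself : IsSelfSimilar X (fun i => (-1) ^ (b i : ℕ)) k (fun i => ⟨d i, hd i⟩)
      (∏ j, (d j).den) e := by
    refine ⟨fun i => neg_one_pow_eq_or ℤ _, hk, Nat.Coprime.prod_left fun i _ => ?_,
      fun i => ?_, fun x => ?_⟩
    · rw [Nat.coprime_comm, (Fact.out : p.Prime).coprime_iff_not_dvd]
      exact (Padic.norm_rat_le_one_iff_padicValuation_le_one p).1 (hd i) |>
        (Rat.padicValuation_le_one_iff).1
    · refine Subtype.ext ?_
      have := congrArg (Rat.cast : ℚ → ℚ_[p]) (he i)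
      rw [Rat.cast_mul, Rat.cast_natCast, Rat.cast_intCast] at this
      exact this
    · constructor
      · intro hx
        have hxK : (x : ℚ_[p]) ∈ K := hx
        rw [hU] at hxK
        obtain ⟨i, y, hy, hxy⟩ := Set.mem_iUnion.1 hxK
        refine ⟨i, ⟨y, hint y hy⟩, hy, Subtype.ext ?_⟩
        dsimp only at hxy
        rw [← hxy]
        push_cast
        rfl
      · rintro ⟨i, y, hy, rfl⟩
        refine hU.symm.subset (Set.mem_iUnion.2 ⟨i, y, hy, ?_⟩)
        push_cast
        rfl
  have hfin : Finite (ResidualState X) :=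
    (hself.finite_wordResiduals.subset fun Y hY => hY.2).to_subtype
  obtain ⟨S, hS⟩ := hself.exists_forall_reach hX
  exact ⟨_, hfin, residualAutomaton X hX, residualAutomaton_isDeterministic,
    himage ▸ residualAutomaton_recognizes hclosed,
    (residualAutomaton X hX).existsUnique_isEssentialClass hS⟩
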